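/- **Theorem 2.** Let $G$ be a causal diagram, i.e. a finite directed acyclic graph whose nodes are random variables with finitely many states, and consider a causal model on $G$: a conditional probability table $P(v_i\mid pa_i)$ for each variable $V_i$ given its parents. Let $P(v)=\prod_i P(v_i\mid pa_i)$ be the resulting observational distribution (compatible with $G$), and let $$P(y\mid do(x))=\sum_{v:\,v_X=x,\,v_Y=y}\ \prod_{i:\,V_i\neq X}P(v_i\mid pa_i)$$ be the causal effect given by truncated factorization. A path (a sequence of distinct nodes, consecutive ones joined by an arrow in either direction) is *blocked* by a set of nodes $Z$ if it contains a chain $A\to B\to C$ or a fork $A\leftarrow B\to C$ with $B\in Z$, or a collider $A\to B\leftarrow C$ such that neither $B$ nor any descendant of $B$ is in $Z$. A *back-door path* from a set of nodes $A$ to a set of nodes $B$ is a path that starts at a node of $A$ with an arrow into that node, ends at a node of $B$, and contains no further node of $A$ and no earlier node of $B$. For distinct nodes $X,Y$, a set $Z$ of nodes with $X,Y\notin Z$ satisfies the *front-door criterion* relative to $(X,Y)$ if (i) every directed path from $X$ to $Y$ contains a node of $Z$; (ii) there is no unblocked back-door path from $X$ to $Z$ (each such path is blocked by $\emptyset$);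 (iii) every back-door path from $Z$ to $Y$ is blocked by $\{X\}$. Let $W,U$ be disjoint sets of variables such that $W\cup U$ satisfies the front-door criterion relative to $(X,Y)$, and suppose $P(x,w,u)>0$ for all states $x$ of $X$, $w$ of $W$ and $u$ of $U$. Suppose that only $P(X,Y,W)$ and $P(U)$ are given. Then for every state $x$ of $X$ and $y$ of $Y$, $$LB\le P(y\mid do(x))\le UB,$$ where $LB$ and $UB$ are the optimal values (infimum and supremum, i.e. minimum and maximum whenever these are attained) of $$\sum_{w,u}\frac{b_{x,w,u}}{P(x)}\sum_{x'}\frac{a_{x',w,u}\,P(x')}{b_{x',w,u}}$$ over all real arrays $a=(a_{x',w,u})$, $b=(b_{x',w,u})$ for which the objective is defined (all $b_{x',w,u}\neq 0$) and which satisfy, for all states $x'$ of $X$ and $w$ of $W$, $$\sum_u a_{x',w,u}=P(x',y,w),\qquad \sum_u b_{x',w,u}=P(x',w),$$ and, for all states $x'$, $w$, $u$, $$b_{x',w,u}\ge a_{x',w,u},$$ $$\max\{0,P(x',y,w)+P(u)-1\}\le a_{x',w,u}\le\min\{P(x',y,w),P(u)\},$$ $$\max\{0,P(x',w)+P(u)-1\}\le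 b_{x',w,u}\le\min\{P(x',w),P(u)\}.$$ Moreover, the set of objective values over this region is nonempty and bounded, so that $LB$ and $UB$ are finite. -/

import Mathlib

/-! ### Causal diagrams, paths and blocking -/

/-- A causal diagram: a directed acyclic graph on the set `V` of variables.
`G.Edge a b` means that there is an arrow from `a` to `b`. -/
structure CausalDiagram (V : Type*) where
  Edge : V → V → Prop
  acyclic : ∀ v, ¬ Relation.TransGen Edge v v

namespace CausalDiagram

variable {V : Type*}

/-- `d` is a descendant of `b`. -/
def Descendant (G : CausalDiagram V) (b d : V) : Prop :=
  Relation.TransGen G.Edge b d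

/-- A directed path from `s` to `t`: every consecutive pair is joined by a forward arrow. -/
def IsDirectedPath (G : CausalDiagram V) (s t : V) (p : List V) : Prop :=
  p.head? = some s ∧ p.getLast? = some t ∧ p.IsChain G.Edge

/-- A path: a sequence of distinct nodes, consecutive ones joined by an arrow in either direction.
(The direction of each arrow is determined by the nodes, since `G` is acyclic.) -/
def IsPath (G : CausalDiagram V) (p : List V) : Prop :=
  p.Nodup ∧ p.IsChain (fun a b => G.Edge a b ∨ G.Edge b a)

/-- The path `p` is blocked by `Z`: it contains a chain or a fork whose middle node is in `Z`,
or a collider which is not in `Z` and has no descendant in `Z`. -/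
def Blocked (G : CausalDiagram V) (Z : Set V) (p : List V) : Prop :=
  ∃ a b c : V, [a, b, c] <:+: p ∧
    ((((G.Edge a b ∧ G.Edge b c) ∨ (G.Edge c b ∧ G.Edge b a) ∨ (G.Edge b a ∧ G.Edge b c)) ∧
        b ∈ Z) ∨
      ((G.Edge a b ∧ G.Edge c b) ∧ b ∉ Z ∧ ∀ d ∈ Z, ¬ G.Descendant b d))

/-- A back-door path from the set `A` to the set `B`: a path that starts in `A` with an arrow into
its first node, ends in `B`, and meets `A` only in its first and `B` only in its last node. -/
def IsBackDoorPath (G : CausalDiagram V) (A B : Set V) (p : List V) : Prop :=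
  G.IsPath p ∧
    (∃ s c l, p = s :: c :: l ∧ G.Edge c s ∧ s ∈ A ∧ ∀ v ∈ c :: l, v ∉ A) ∧
    (∃ l t, p = l ++ [t] ∧ t ∈ B ∧ ∀ v ∈ l, v ∉ B)

/-- The front-door criterion for the set `Z` relative to the ordered pair `(X, Y)`. -/
structure FrontDoor (G : CausalDiagram V) (X Y : V) (Z : Set V) : Prop where
  ne : X ≠ Y
  left_notMem : X ∉ Z
  right_notMem : Y ∉ Z
  /-- `Z` intercepts all directed paths from `X` to `Y`. -/
  intercepts : ∀ p, G.IsDirectedPath X Y p → ∃ z ∈ Z, z ∈ p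
  /-- There is no unblocked back-door path from `X` to `Z`. -/
  no_backDoor : ∀ p, G.IsBackDoorPath {X} Z p → G.Blocked ∅ p
  /-- All back-door paths from `Z` to `Y` are blocked by `X`. -/
  backDoor_blocked : ∀ p, G.IsBackDoorPath Z {Y} p → G.Blocked {X} p

end CausalDiagram

/-! ### Causal models, observational distribution and interventions -/

/-- A causal model with diagram `G` and finite state spaces `S v`: for each variable a conditional
probability table given the states of its parents. -/
structure CausalModel {V : Type*} (G : CausalDiagram V) (S : V → Type*)
    [∀ v, Fintype (S v)] where
  cpt : ∀ v, ((u : {u // G.Edge u v}) → S u) → S v → ℝ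
  cpt_nonneg : ∀ v q s, 0 ≤ cpt v q s
  cpt_sum : ∀ v q, ∑ s, cpt v q s = 1

namespace CausalModel

variable {V : Type*} [Fintype V] [DecidableEq V] {G : CausalDiagram V} {S : V → Type*}
  [∀ v, Fintype (S v)] [∀ v, DecidableEq (S v)]

/-- The factor `P(ω_v | pa_v)` of the full assignment `ω`. -/
def factor (M : CausalModel G S) (ω : ∀ v, S v) (v : V) : ℝ :=
  M.cpt v (fun u => ω u) (ω v)

/-- The observational joint distribution: the distribution compatible with `G` with the given
conditional probability tables. -/
def joint (M : CausalModel G S) (ω : ∀ v, S v) : ℝ :=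
  ∏ v, M.factor ω v

/-- The joint distribution under the intervention `do(X = x)`: truncated factorization. -/
def doJoint (M : CausalModel G S) (X : V) (x : S X) (ω : ∀ v, S v) : ℝ :=
  if ω X = x then ∏ v ∈ Finset.univ.erase X, M.factor ω v else 0

/-- The causal effect `P(Y = y | do(X = x))`. -/
def causalEffect (M : CausalModel G S) (X Y : V) (x : S X) (y : S Y) : ℝ :=
  ∑ ω : (∀ v, S v), if ω Y = y then M.doJoint X x ω else 0

/-- The marginal `P(x, y, w)`. -/
def probXYW (M : CausalModel G S) (X Y : V) (W : Finset V)
    (x : S X) (y : S Y) (w : (v : W) → S v) : ℝ :=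
  ∑ ω : (∀ v, S v), if ω X = x ∧ ω Y = y ∧ (fun v : W => ω v) = w then M.joint ω else 0

/-- The marginal `P(u)`. -/
def probU (M : CausalModel G S) (U : Finset V) (u : (v : U) → S v) : ℝ :=
  ∑ ω : (∀ v, S v), if (fun v : U => ω v) = u then M.joint ω else 0

/-- The marginal `P(x, w, u)`. -/
def probXWU (M : CausalModel G S) (X : V) (W U : Finset V)
    (x : S X) (w : (v : W) → S v) (u : (v : U) → S v) : ℝ :=
  ∑ ω : (∀ v, S v),
    if ω X = x ∧ (fun v : W => ω v) = w ∧ (fun v : U => ω v) = u then M.joint ω else 0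

end CausalModel

/-! ### The optimization problem

It depends only on the table `pxyw` of `P(X, Y, W)` and the table `pu` of `P(U)`;
`α`, `β`, `γ`, `δ` are the sets of states of `X`, `Y`, `W`, `U`. -/

namespace FrontDoorProblem

variable {α β γ δ : Type*} [Fintype α] [Fintype β] [Fintype γ] [Fintype δ]

/-- `P(x, w)` -/
def pxw (pxyw : α → β → γ → ℝ) (x : α) (w : γ) : ℝ := ∑ y, pxyw x y w

/-- `P(x)` -/
def px (pxyw : α → β → γ → ℝ) (x : α) : ℝ := ∑ w, pxw pxyw x w

/-- The constraints of the optimization problem for the outcome `y`. -/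
structure Feasible (pxyw : α → β → γ → ℝ) (pu : δ → ℝ) (y : β) (a b : α → γ → δ → ℝ) :
    Prop where
  sum_a : ∀ x w, ∑ u, a x w u = pxyw x y w
  sum_b : ∀ x w, ∑ u, b x w u = pxw pxyw x w
  a_le_b : ∀ x w u, a x w u ≤ b x w u
  le_a : ∀ x w u, max 0 (pxyw x y w + pu u - 1) ≤ a x w u
  a_le : ∀ x w u, a x w u ≤ min (pxyw x y w) (pu u)
  le_b : ∀ x w u, max 0 (pxw pxyw x w + pu u - 1) ≤ b x w u
  b_le : ∀ x w u, b x w u ≤ min (pxw pxyw x w) (pu u)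

/-- The objective function. -/
noncomputable def objective (pxyw : α → β → γ → ℝ) (x : α) (a b : α → γ → δ → ℝ) : ℝ :=
  ∑ w, ∑ u, b x w u / px pxyw x * ∑ x', a x' w u * px pxyw x' / b x' w u

/-- The values of the objective at the feasible points where it is defined,
that is, where no denominator `b x' w u` vanishes. -/
def values (pxyw : α → β → γ → ℝ) (pu : δ → ℝ) (x : α) (y : β) : Set ℝ :=
  {t | ∃ a b : α → γ → δ → ℝ, Feasible pxyw pu y a b ∧ (∀ x' w u, b x' w u ≠ 0) ∧
    objective pxyw x a b = t}

end FrontDoorProblem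

/-! ### Treks and unblocked back-door paths. -/

namespace CausalDiagram

variable {V : Type*} (G : CausalDiagram V)

/-! The true tables a = P(x,y,w,u) and b = P(x,w,u) form a feasible point (`feasible`): they have
the right marginals and obey the Fréchet bounds. The objective there is the front-door formula,
hence the causal effect (`objective_eq_causalEffect`). So the effect is itself one of the objective
values, and since these are bounded (`values_subset_Icc`) it lies between their infimum and
supremum.

The substance is front-door adjustment for Z = W ∪ U, derived from path blocking. Let B be the nodes
leading to Z while avoiding X, T the proper ancestors of X, and E the union of T with the nodes
leading to Y while avoiding Z ∪ {X}. If these sets overlapped where they must not, a last node of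
overlap would send out two directed paths meeting only there; together they form a collider-free,
hence unblocked, back-door path. This gives `FrontDoor.exists_partition`.

Factorizing along the partition gives P(x,z) = F(x,z) K(x), where F sums the tables of B ∪ Z over B,
and K sums those of E and X over E. Here K(x) = P(x), so F(x,z) = P(z|x). Likewise P(x,y,z) = F(x,z)
L(x,y,z), and P(y|do(x)) is the sum over z of F(x,z) times the sum of L(x',y,z) over x'. Eliminating
F and L gives the adjustment formula (`frontDoor_adjustment`). -/

lemma not_edge_of_edge {a b : V} (h : G.Edge a b) : ¬ G.Edge b a := fun h' =>
  G.acyclic a ((Relation.TransGen.single h).tail h')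

lemma nodup_of_isChain {l : List V} (h : l.IsChain G.Edge) : l.Nodup := by
  have h1 : l.IsChain (Relation.TransGen G.Edge) := h.imp fun _ _ => Relation.TransGen.single
  have h2 : l.Pairwise (Relation.TransGen G.Edge) := List.isChain_iff_pairwise.1 h1
  refine h2.imp fun {a b} hab hne => ?_
  subst hne
  exact G.acyclic _ hab

/-- A trek, that is, a reversed directed path followed by a directed path, has no collider. -/
lemma not_collider_of_trek {v : V} {q : List V} (hq : (v :: q).IsChain G.Edge) :
    ∀ {l : List V}, (l ++ [v]).IsChain (flip G.Edge) →
      ∀ {a b c : V}, [a, b, c] <:+: l ++ v :: q → ¬ (G.Edge a b ∧ G.Edge c b)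
  | [], _, a, b, c, h, hc => by
    have h3 : [a, b, c].IsChain G.Edge := hq.infix h
    simp only [List.isChain_cons_cons] at h3
    exact G.not_edge_of_edge h3.2.1 hc.2
  | d :: l, hl, a, b, c, h, hc => by
    rw [List.cons_append, List.infix_cons_iff] at h
    rcases h with h | h
    · obtain ⟨rfl, hbc⟩ := List.cons_prefix_cons.1 h
      -- A triple starting on the reversed leg has its first arrow pointing back, from b to a.
      have hba : G.Edge b a := by
        cases l with
        | nil =>
          obtain ⟨rfl, -⟩ := List.cons_prefix_cons.1 hbc
          simpa [flip] using hl
        | cons e l =>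
          obtain ⟨rfl, -⟩ := List.cons_prefix_cons.1 hbc
          simp only [List.cons_append, List.isChain_cons_cons] at hl
          exact hl.1
      exact G.not_edge_of_edge hba hc.1
    · exact not_collider_of_trek hq (by
        rw [List.cons_append] at hl; exact hl.tail) h hc

/-- Two directed paths from a node `v` that meet only in `v` form a path. -/
lemma isPath_trek {v : V} {p q : List V} (hp : (v :: p).IsChain G.Edge)
    (hq : (v :: q).IsChain G.Edge) (hpq : ∀ a ∈ p, a ∉ q) : G.IsPath (p.reverse ++ v :: q) := by
  have hnp := G.nodup_of_isChain hp
  have hnq := G.nodup_of_isChain hq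
  constructor
  · rw [List.nodup_append']
    refine ⟨List.nodup_reverse.2 hnp.of_cons, hnq, ?_⟩
    intro a ha hb
    rw [List.mem_reverse] at ha
    rcases List.mem_cons.1 hb with rfl | hb
    · exact (List.nodup_cons.1 hnp).1 ha
    · exact hpq a ha hb
  · have h1 : (p.reverse ++ [v]).IsChain (fun a b => G.Edge a b ∨ G.Edge b a) := by
      have h := List.isChain_reverse.2 (hp.imp (S := flip (flip G.Edge)) fun _ _ h => h)
      rw [List.reverse_cons] at h
      exact h.imp fun _ _ h => Or.inr h
    have h2 : (v :: q).IsChain (fun a b => G.Edge a b ∨ G.Edge b a) :=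
      hq.imp fun _ _ h => Or.inl h
    simpa using List.IsChain.append_overlap h1 h2 (by simp)

/-- The path formed by directed paths from `v` to `t ∈ A` and from `v` to `e ∈ B`
is a back-door path which is blocked only by its non-colliders. -/
lemma exists_backDoorPath {v t e : V} {p q l : List V} {A B : Set V}
    (hp : (v :: (p ++ [t])).IsChain G.Edge) (hq : (v :: q).IsChain G.Edge) (hl : v :: q = l ++ [e])
    (hpq : ∀ a ∈ p ++ [t], a ∉ q) (htA : t ∈ A) (hpA : ∀ a ∈ v :: p, a ∉ A) (hqA : ∀ a ∈ q, a ∉ A)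
    (heB : e ∈ B) (hpB : ∀ a ∈ p ++ [t], a ∉ B) (hlB : ∀ a ∈ l, a ∉ B) :
    ∃ m, G.IsBackDoorPath A B m ∧
      ∀ C : Set V, (∀ a ∈ p ++ [t], a ∉ C) → (∀ a ∈ v :: q, a ∉ C) → ¬ G.Blocked C m := by
  have hrev : ((p ++ [t]).reverse ++ [v]).IsChain (flip G.Edge) := by
    have h := List.isChain_reverse.2 (hp.imp (S := flip (flip G.Edge)) fun _ _ h => h)
    rwa [List.reverse_cons] at h
  refine ⟨(p ++ [t]).reverse ++ v :: q, ⟨G.isPath_trek hp hq hpq, ?_, ?_⟩, ?_⟩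
  · have hr : (p ++ [t]).reverse = t :: p.reverse := by simp
    -- The node c precedes t on the leg from v (it is v itself when p is empty), so the trek starts
    -- with an arrow into t.
    obtain ⟨c, m, hm⟩ : ∃ c m, p.reverse ++ [v] = c :: m :=
      List.exists_cons_of_ne_nil (by simp)
    refine ⟨t, c, m ++ q, ?_, ?_, htA, ?_⟩
    · rw [hr, ← List.cons_append (a := c), ← hm]; simp
    · rw [hr, List.cons_append, hm] at hrev
      simp only [List.isChain_cons_cons] at hrev
      exact hrev.1
    · intro a ha
      rw [← List.cons_append, ← hm] at ha
      simp only [List.mem_append, List.mem_reverse, List.mem_singleton] at ha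
      rcases ha with (ha | rfl) | ha
      · exact hpA a (List.mem_cons_of_mem _ ha)
      · exact hpA a List.mem_cons_self
      · exact hqA a ha
  · refine ⟨(p ++ [t]).reverse ++ l, e, by rw [hl, List.append_assoc], heB, ?_⟩
    intro a ha
    rcases List.mem_append.1 ha with ha | ha
    · exact hpB a (List.mem_reverse.1 ha)
    · exact hlB a ha
  · rintro C hpC hqC ⟨a, b, c, habc, ⟨-, hb⟩ | ⟨hc, -⟩⟩
    · have hbm : b ∈ (p ++ [t]).reverse ++ v :: q := habc.subset (by simp)
      rcases List.mem_append.1 hbm with h | h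
      · exact hpC b (List.mem_reverse.1 h) hb
      · exact hqC b h hb
    · exact G.not_collider_of_trek hq hrev habc hc

end CausalDiagram

/-- A chain realizing `TransGen r v t`. -/
lemma Relation.TransGen.exists_isChain {V : Type*} {r : V → V → Prop} {v t : V}
    (h : Relation.TransGen r v t) :
    ∃ p : List V, (v :: (p ++ [t])).IsChain r ∧ (∀ a ∈ v :: p, Relation.TransGen r a t) ∧
      ∀ a ∈ p ++ [t], Relation.TransGen r v a := by
  induction h using Relation.TransGen.head_induction_on with
  | single h => exact ⟨[], by simpa using h, by simpa using .single h, by simpa using .single h⟩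
  | @head a c hac hct ih =>
    obtain ⟨p, hp, h1, h2⟩ := ih
    refine ⟨c :: p, ?_, ?_, ?_⟩
    · rw [List.cons_append, List.isChain_cons_cons]
      exact ⟨hac, hp⟩
    · intro b hb
      rcases List.mem_cons.1 hb with rfl | hb
      · exact .head hac hct
      · exact h1 b hb
    · intro b hb
      rw [List.cons_append] at hb
      rcases List.mem_cons.1 hb with rfl | hb
      · exact .single hac
      · exact .head hac (h2 b hb)

/-! ### Ancestral sets determined by the front-door criterion. -/

namespace CausalDiagram

variable {V : Type*} (G : CausalDiagram V)

/-- An arrow whose tail is neither `X` nor in `Z`. -/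
def AvoidingEdge (X : V) (Z : Set V) (a b : V) : Prop := G.Edge a b ∧ a ∉ Z ∧ a ≠ X

variable {G}

/-- Nodes outside `Z ∪ {X}` with a directed path to `Z` that avoids `X`. -/
def AncestorOfSet (G : CausalDiagram V) (X : V) (Z : Set V) (v : V) : Prop :=
  ∃ z ∈ Z, Relation.TransGen (G.AvoidingEdge X Z) v z

/-- Nodes outside `Z ∪ {X}` with a directed path to `Y` that avoids `Z ∪ {X}`. -/
def AncestorOfOutcome (G : CausalDiagram V) (X Y : V) (Z : Set V) (v : V) : Prop :=
  v ∉ Z ∧ v ≠ X ∧ Relation.ReflTransGen (G.AvoidingEdge X Z) v Y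

lemma transGen_of_avoiding {X : V} {Z : Set V} {a b : V}
    (h : Relation.TransGen (G.AvoidingEdge X Z) a b) : Relation.TransGen G.Edge a b :=
  Relation.TransGen.mono (fun _ _ h => h.1 : G.AvoidingEdge X Z ≤ G.Edge) _ _ h

lemma AncestorOfSet.notMem {X : V} {Z : Set V} {v : V} (h : G.AncestorOfSet X Z v) :
    v ∉ Z ∧ v ≠ X := by
  obtain ⟨z, -, h⟩ := h
  obtain ⟨c, h, -⟩ := Relation.TransGen.head'_iff.1 h
  exact h.2

lemma AncestorOfSet.of_edge {X : V} {Z : Set V} {a b : V} (hab : G.Edge a b)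
    (hb : G.AncestorOfSet X Z b ∨ b ∈ Z) (haZ : a ∉ Z) (haX : a ≠ X) : G.AncestorOfSet X Z a := by
  rcases hb with ⟨z, hz, h⟩ | hb
  · exact ⟨z, hz, .head ⟨hab, haZ, haX⟩ h⟩
  · exact ⟨b, hb, .single ⟨hab, haZ, haX⟩⟩

lemma AncestorOfOutcome.of_edge {X Y : V} {Z : Set V} {a b : V} (hab : G.Edge a b)
    (hb : G.AncestorOfOutcome X Y Z b) (haZ : a ∉ Z) (haX : a ≠ X) :
    G.AncestorOfOutcome X Y Z a :=
  ⟨haZ, haX, .head ⟨hab, haZ, haX⟩ hb.2.2⟩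

/-- Induction along this relation assumes the claim for all proper descendants, which amounts to
choosing a last counterexample. -/
lemma wellFounded_descendant [Finite V] (G : CausalDiagram V) :
    WellFounded fun a b => Relation.TransGen G.Edge b a := by
  have : IsTrans V fun a b => Relation.TransGen G.Edge b a := ⟨fun _ _ _ h h' => h'.trans h⟩
  have : Std.Irrefl fun a b => Relation.TransGen G.Edge b a := ⟨G.acyclic⟩
  exact Finite.wellFounded_of_trans_of_irrefl _

lemma wellFounded_edge [Finite V] (G : CausalDiagram V) : WellFounded G.Edge := by
  have : IsTrans V (Relation.TransGen G.Edge) := ⟨fun _ _ _ h h' => h.trans h'⟩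
  have : Std.Irrefl (Relation.TransGen G.Edge) := ⟨G.acyclic⟩
  exact Subrelation.wf Relation.TransGen.single
    (Finite.wellFounded_of_trans_of_irrefl (Relation.TransGen G.Edge))

variable {X Y : V} {Z : Set V}

/-- No proper ancestor of `X` lies in `Z` or has a directed path to `Z` avoiding `X`. -/
lemma FrontDoor.not_confounded [Finite V] (h : G.FrontDoor X Y Z) (v : V) :
    Relation.TransGen G.Edge v X → ¬ (v ∈ Z ∨ G.AncestorOfSet X Z v) := by
  induction v using G.wellFounded_descendant.induction with
  | _ v ih =>
  intro hvX hv
  obtain ⟨p, hp, hpX, hvp⟩ := hvX.exists_isChain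
  -- By induction no later node on the leg to X can start, or lie on, the leg to Z; so the two legs
  -- meet only in v.
  have hpfree : ∀ a ∈ p ++ [X], ¬ (a ∈ Z ∨ G.AncestorOfSet X Z a) := by
    intro a ha
    rcases List.mem_append.1 ha with ha' | ha'
    · exact ih a (hvp a ha) (hpX a (List.mem_cons_of_mem _ ha'))
    · rw [List.mem_singleton.1 ha']
      rintro (h' | h')
      · exact h.left_notMem h'
      · exact h'.notMem.2 rfl
  have hpX' : ∀ a ∈ v :: p, a ∉ ({X} : Set V) := by
    rintro a ha rfl
    exact G.acyclic _ (hpX _ ha)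
  -- The second leg ends at its first node e of Z; it is trivial when v is already in Z.
  obtain ⟨q, l, e, hq, hl, he, hlZ, hqX⟩ : ∃ q l e, (v :: q).IsChain G.Edge ∧ v :: q = l ++ [e] ∧
      e ∈ Z ∧ (∀ a ∈ l, a ∉ Z) ∧ ∀ a ∈ q, a ∈ Z ∨ G.AncestorOfSet X Z a := by
    rcases hv with hv | ⟨z, hz, hv⟩
    · exact ⟨[], [], v, by simp, rfl, hv, by simp, by simp⟩
    · obtain ⟨q, hq, hqz, -⟩ := hv.exists_isChain
      refine ⟨q ++ [z], v :: q, z, hq.imp fun _ _ h => h.1, rfl, hz, ?_, ?_⟩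
      · intro a ha
        exact (AncestorOfSet.notMem ⟨z, hz, hqz a ha⟩).1
      · intro a ha
        rcases List.mem_append.1 ha with ha | ha
        · exact Or.inr ⟨z, hz, hqz a (List.mem_cons_of_mem _ ha)⟩
        · rw [List.mem_singleton.1 ha]; exact Or.inl hz
  obtain ⟨m, hm, hm'⟩ := G.exists_backDoorPath (A := {X}) (B := Z) hp hq hl
    (fun a ha haq => hpfree a ha (hqX a haq)) rfl hpX'
    (by
      rintro a ha rfl
      rcases hqX _ ha with h' | h'
      · exact h.left_notMem h'
      · exact h'.notMem.2 rfl)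
    he (fun a ha haZ => hpfree a ha (Or.inl haZ)) hlZ
  exact hm' ∅ (by simp) (by simp) (h.no_backDoor m hm)

/-- No node has both a directed path to `Z` avoiding `X` and one to `Y` avoiding `Z ∪ {X}`. -/
lemma FrontDoor.not_ancestorOfOutcome [Finite V] (h : G.FrontDoor X Y Z) (v : V) :
    G.AncestorOfSet X Z v → ¬ G.AncestorOfOutcome X Y Z v := by
  induction v using G.wellFounded_descendant.induction with
  | _ v ih =>
  intro hvZ hvY
  have hvX := hvZ.notMem.2
  obtain ⟨z, hz, hvz⟩ := hvZ
  obtain ⟨p, hp, hpz, hvp⟩ := hvz.exists_isChain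
  have hpset : ∀ a ∈ v :: p, G.AncestorOfSet X Z a := fun a ha => ⟨z, hz, hpz a ha⟩
  have hpfree : ∀ a ∈ p ++ [z], ¬ G.AncestorOfOutcome X Y Z a := by
    intro a ha
    rcases List.mem_append.1 ha with ha' | ha'
    · exact ih a (transGen_of_avoiding (hvp a ha)) (hpset a (List.mem_cons_of_mem _ ha'))
    · rw [List.mem_singleton.1 ha']
      exact fun h' => h'.1 hz
  have hY : G.AncestorOfOutcome X Y Z Y := ⟨h.right_notMem, h.ne.symm, .refl⟩
  obtain ⟨q, l, hq, hl, hlY, hqY⟩ : ∃ q l, (v :: q).IsChain G.Edge ∧ v :: q = l ++ [Y] ∧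
      (∀ a ∈ l, a ∉ ({Y} : Set V)) ∧ ∀ a ∈ q, G.AncestorOfOutcome X Y Z a := by
    rcases Relation.reflTransGen_iff_eq_or_transGen.1 hvY.2.2 with rfl | hv
    · exact ⟨[], [], by simp, rfl, by simp, by simp⟩
    · obtain ⟨q, hq, hqY, -⟩ := hv.exists_isChain
      refine ⟨q ++ [Y], v :: q, hq.imp fun _ _ h => h.1, rfl, ?_, ?_⟩
      · rintro a ha rfl
        exact G.acyclic _ (transGen_of_avoiding (hqY _ ha))
      · intro a ha
        rcases List.mem_append.1 ha with ha | ha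
        · have ht := hqY a (List.mem_cons_of_mem _ ha)
          obtain ⟨c, hc, -⟩ := Relation.TransGen.head'_iff.1 ht
          exact ⟨hc.2.1, hc.2.2, ht.to_reflTransGen⟩
        · rw [List.mem_singleton.1 ha]; exact hY
  obtain ⟨m, hm, hm'⟩ := G.exists_backDoorPath (A := Z) (B := {Y}) (hp.imp fun _ _ h => h.1) hq hl
    (fun a ha haq => hpfree a ha (hqY a haq)) hz (fun a ha => (hpset a ha).notMem.1)
    (fun a ha => (hqY a ha).1) rfl
    (by rintro a ha rfl; exact hpfree _ ha hY) hlY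
  refine hm' {X} ?_ ?_ (h.backDoor_blocked m hm)
  · rintro a ha rfl
    rcases List.mem_append.1 ha with ha | ha
    · exact (hpset _ (List.mem_cons_of_mem _ ha)).notMem.2 rfl
    · rw [List.mem_singleton.1 ha] at h
      exact h.left_notMem hz
  · rintro a ha rfl
    rcases List.mem_cons.1 ha with rfl | ha
    · exact hvX rfl
    · exact (hqY _ ha).2.1 rfl

/-- There is no arrow from `X` to a node with a directed path to `Y` avoiding `Z`. -/
lemma FrontDoor.not_edge (h : G.FrontDoor X Y Z) {v : V} (hv : G.AncestorOfOutcome X Y Z v) :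
    ¬ G.Edge X v := by
  intro hXv
  obtain ⟨l, hl, hlast⟩ := List.exists_isChain_cons_of_relationReflTransGen hv.2.2
  -- Every node but the last is the tail of an avoiding arrow, and the last is Y.
  have hmem : ∀ a ∈ v :: l, a ∉ Z := by
    intro a ha haZ
    obtain ⟨s, t, hst⟩ := List.append_of_mem ha
    cases t with
    | nil =>
      have : a = Y := by rw [← hlast]; simp [hst]
      exact h.right_notMem (this ▸ haZ)
    | cons c t =>
      have h2 : [a, c] <:+: v :: l := ⟨s, t, by rw [hst]; simp⟩
      have h3 := hl.infix h2
      simp only [List.isChain_cons_cons] at h3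
      exact h3.1.2.1 haZ
  obtain ⟨z, hz, hzl⟩ := h.intercepts (X :: v :: l)
    ⟨rfl, by rw [List.getLast?_cons_cons, List.getLast?_eq_getLast_of_ne_nil (by simp), hlast],
      List.isChain_cons_cons.2 ⟨hXv, hl.imp fun _ _ h => h.1⟩⟩
  rcases List.mem_cons.1 hzl with rfl | hzl
  · exact h.left_notMem hz
  · exact hmem z hzl hz

end CausalDiagram

/-! ### Calculus of partial sums over coordinates. -/

section PartialSums

variable {V : Type*} [Fintype V] [DecidableEq V] {S : V → Type*}
  [∀ v, Fintype (S v)] [∀ v, DecidableEq (S v)]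

/-- Summation over the coordinates in `A`, the others being kept fixed. -/
def sumOver (A : Finset V) (f : (∀ v, S v) → ℝ) (ω : ∀ v, S v) : ℝ :=
  ∑ σ : (∀ v, S v), if ∀ v, v ∉ A → σ v = ω v then f σ else 0

/-- Turns a marginal, defined by an indicator fixing some coordinates, into a partial sum over the
complementary ones. -/
lemma sumOver_eq_sum_ite (A : Finset V) (f : (∀ v, S v) → ℝ) (ω : ∀ v, S v)
    (p : (∀ v, S v) → Prop) [DecidablePred p] (hp : ∀ σ, p σ ↔ ∀ v, v ∉ A → σ v = ω v) :
    ∑ σ : (∀ v, S v), (if p σ then f σ else 0) = sumOver A f ω :=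
  Finset.sum_congr rfl fun σ _ => if_congr (hp σ) rfl rfl

lemma sumOver_univ (f : (∀ v, S v) → ℝ) (ω : ∀ v, S v) :
    sumOver Finset.univ f ω = ∑ σ : (∀ v, S v), f σ := by
  simp [sumOver]

lemma sumOver_mul_left {A : Finset V} {D : Set V} {f : (∀ v, S v) → ℝ} (hf : DependsOn f D)
    (hD : ∀ v ∈ D, v ∉ A) (g : (∀ v, S v) → ℝ) :
    sumOver A (fun σ => f σ * g σ) = fun ω => f ω * sumOver A g ω := by
  funext ω
  rw [sumOver, sumOver, Finset.mul_sum]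
  refine Finset.sum_congr rfl fun σ _ => ?_
  split_ifs with hσ
  · rw [hf fun v hv => hσ v (hD v hv)]
  · rw [mul_zero]

lemma sumOver_sumOver {A B : Finset V} (hAB : Disjoint A B) (f : (∀ v, S v) → ℝ) :
    sumOver A (sumOver B f) = sumOver (A ∪ B) f := by
  funext ω
  have h : ∀ σ, (if ∀ v, v ∉ A → σ v = ω v then sumOver B f σ else 0) =
      ∑ τ : (∀ v, S v), if (∀ v, v ∉ A → σ v = ω v) ∧ (∀ v, v ∉ B → τ v = σ v)
        then f τ else 0 := by
    intro σ
    by_cases hσ : ∀ v, v ∉ A → σ v = ω v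
    · rw [if_pos hσ]
      exact Finset.sum_congr rfl fun τ _ => if_congr (and_iff_right hσ).symm rfl rfl
    · rw [if_neg hσ]
      exact (Finset.sum_eq_zero fun τ _ => if_neg fun h => hσ h.1).symm
  rw [sumOver, Finset.sum_congr rfl fun σ _ => h σ, Finset.sum_comm]
  refine Finset.sum_congr rfl fun τ _ => ?_
  -- For given ω and τ the intermediate assignment is forced: it agrees with ω on B, which A does
  -- not meet, and with τ elsewhere.
  rw [Finset.sum_eq_single (fun v => if v ∈ B then ω v else τ v)]
  · refine if_congr ⟨fun h v hv => ?_, fun h => ⟨fun v hv => ?_, fun v hv => ?_⟩⟩ rfl rfl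
    · rw [Finset.mem_union, not_or] at hv
      simpa [hv.2] using h.1 v hv.1
    · by_cases hB : v ∈ B
      · simp [hB]
      · simpa [hB] using h v (by simp [hv, hB])
    · simp [hv]
  · intro σ _ hne
    refine if_neg fun h => hne (funext fun v => ?_)
    by_cases hB : v ∈ B
    · simpa [hB] using h.1 v (Finset.disjoint_right.1 hAB hB)
    · simpa [hB] using (h.2 v hB).symm
  · simp

lemma sumOver_eq_sum_subtype (A : Finset V) (f : (∀ v, S v) → ℝ) (ω : ∀ v, S v) :
    sumOver A f ω =
      ∑ s : ((v : A) → S v), f fun v => if h : v ∈ A then s ⟨v, h⟩ else ω v := by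
  rw [sumOver, ← Finset.sum_filter]
  refine Finset.sum_bij' (fun σ _ v => σ v) (fun s _ v => if h : v ∈ A then s ⟨v, h⟩ else ω v)
    ?_ ?_ ?_ ?_ ?_
  · simp
  · intro s _
    simp only [Finset.mem_filter, Finset.mem_univ, true_and]
    intro v hv
    simp [hv]
  · intro σ hσ
    simp only [Finset.mem_filter, Finset.mem_univ, true_and] at hσ
    funext v
    by_cases hv : v ∈ A
    · simp [hv]
    · simp [hv, hσ v hv]
  · intro s _
    funext v
    simp
  · intro σ hσ
    simp only [Finset.mem_filter, Finset.mem_univ, true_and] at hσ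
    congr 1
    funext v
    by_cases hv : v ∈ A
    · simp [hv]
    · simp [hv, hσ v hv]

lemma DependsOn.sumOver {f : (∀ v, S v) → ℝ} {D D' : Set V} (hf : DependsOn f D) (A : Finset V)
    (hD : ∀ v ∈ D, v ∉ A → v ∈ D') : DependsOn (sumOver A f) D' := by
  intro σ τ h
  rw [sumOver_eq_sum_subtype, sumOver_eq_sum_subtype]
  refine Finset.sum_congr rfl fun s _ => hf fun v hv => ?_
  by_cases hA : v ∈ A
  · simp [hA]
  · simpa [hA] using h v (hD v hv hA)

lemma sumOver_singleton (X : V) (f : (∀ v, S v) → ℝ) (ω : ∀ v, S v) :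
    sumOver {X} f ω = ∑ s : S X, f (Function.update ω X s) := by
  rw [sumOver, ← Finset.sum_filter]
  refine Finset.sum_bij' (fun σ _ => σ X) (fun s _ => Function.update ω X s) ?_ ?_ ?_ ?_ ?_
  · simp
  · intro s _
    simp only [Finset.mem_filter, Finset.mem_univ, true_and, Finset.mem_singleton]
    intro v hv
    exact Function.update_of_ne hv _ _
  · intro σ hσ
    simp only [Finset.mem_filter, Finset.mem_univ, true_and, Finset.mem_singleton] at hσ
    funext v
    by_cases hv : v = X
    · subst hv; simp
    · simp [hv, hσ v hv]
  · simp
  · intro σ hσ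
    simp only [Finset.mem_filter, Finset.mem_univ, true_and, Finset.mem_singleton] at hσ
    congr 1
    funext v
    by_cases hv : v = X
    · subst hv; simp
    · simp [hv, hσ v hv]

/-- Replace the coordinates of `ω` in `W` and `U` by `w` and `u`. -/
def mergeStates {W U : Finset V} (ω : ∀ v, S v) (w : (v : W) → S v) (u : (v : U) → S v) :
    ∀ v, S v :=
  fun v => if h : v ∈ W then w ⟨v, h⟩ else if h : v ∈ U then u ⟨v, h⟩ else ω v

lemma sumOver_union_eq_sum_sum {W U : Finset V} (hWU : Disjoint W U) (f : (∀ v, S v) → ℝ)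
    (ω : ∀ v, S v) :
    sumOver (W ∪ U) f ω =
      ∑ w : ((v : W) → S v), ∑ u : ((v : U) → S v), f (mergeStates ω w u) := by
  rw [← sumOver_sumOver hWU, sumOver_eq_sum_subtype]
  refine Finset.sum_congr rfl fun w _ => ?_
  rw [sumOver_eq_sum_subtype]
  refine Finset.sum_congr rfl fun u _ => congrArg f (funext fun v => ?_)
  by_cases hW : v ∈ W
  · simp [mergeStates, hW, Finset.disjoint_left.1 hWU hW]
  · simp [mergeStates, hW]

end PartialSums

/-! ### Summing out conditional probability tables. -/

namespace CausalModel

section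

variable {V : Type*} {G : CausalDiagram V} {S : V → Type*} [∀ v, Fintype (S v)]
  (M : CausalModel G S)

lemma factor_nonneg (ω : ∀ v, S v) (v : V) : 0 ≤ M.factor ω v := M.cpt_nonneg _ _ _

lemma joint_nonneg [Fintype V] (ω : ∀ v, S v) : 0 ≤ M.joint ω :=
  Finset.prod_nonneg fun v _ => M.factor_nonneg ω v

/-- A row summing to 1 cannot be empty; exhibiting a row needs states for the parents, hence the
induction along arrows. -/
lemma nonempty_state [Finite V] (M : CausalModel G S) (v : V) : Nonempty (S v) := by
  induction v using G.wellFounded_edge.induction with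
  | _ v ih =>
  have q : (u : {u // G.Edge u v}) → S u := fun u => (ih u u.2).some
  by_contra h
  rw [not_nonempty_iff] at h
  have := M.cpt_sum v q
  rw [Finset.univ_eq_empty, Finset.sum_empty] at this
  exact zero_ne_one this

lemma dependsOn_factor (v : V) :
    DependsOn (fun ω => M.factor ω v) {u | u = v ∨ G.Edge u v} := by
  intro σ τ h
  have h1 : (fun u : {u // G.Edge u v} => σ u) = fun u : {u // G.Edge u v} => τ u :=
    funext fun u => h u (Or.inr u.2)
  simp only [factor]
  rw [h1, h v (Or.inl rfl)]

lemma dependsOn_prod_factor {A : Finset V} {D : Set V} (hA : ∀ v ∈ A, v ∈ D)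
    (hD : ∀ u, ∀ v ∈ A, G.Edge u v → u ∈ D) :
    DependsOn (fun ω => ∏ v ∈ A, M.factor ω v) D := by
  intro σ τ h
  refine Finset.prod_congr rfl fun v hv => M.dependsOn_factor v ?_
  rintro u (rfl | hu)
  · exact h _ (hA _ hv)
  · exact h _ (hD _ _ hv hu)

end

variable {V : Type*} [Fintype V] [DecidableEq V] {G : CausalDiagram V} {S : V → Type*}
  [∀ v, Fintype (S v)] [∀ v, DecidableEq (S v)] (M : CausalModel G S)

/-- No node is its own parent, so varying the state of v runs through a single row of its table. -/
lemma sumOver_factor (v : V) (ω : ∀ v, S v) : sumOver {v} (fun σ => M.factor σ v) ω = 1 := by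
  rw [sumOver_singleton]
  have h : ∀ s : S v, M.factor (Function.update ω v s) v = M.cpt v (fun u => ω u) s := by
    intro s
    have h1 : (fun u : {u // G.Edge u v} => Function.update ω v s u) =
        fun u : {u // G.Edge u v} => ω u := by
      funext u
      refine Function.update_of_ne ?_ _ _
      intro h
      exact G.acyclic v (.single (by simpa [h] using u.2))
    simp only [factor]
    rw [h1, Function.update_self]
  simp_rw [h]
  exact M.cpt_sum _ _

/-- Conditional probability tables of any set of variables sum to one. -/
lemma sumOver_prod_factor (A : Finset V) (ω : ∀ v, S v) :
    sumOver A (fun σ => ∏ v ∈ A, M.factor σ v) ω = 1 := by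
  induction A using Finset.strongInduction generalizing ω with
  | _ A ih =>
  rcases A.eq_empty_or_nonempty with rfl | hA
  · simp only [Finset.prod_empty, sumOver, Finset.notMem_empty, not_false_eq_true, true_imp_iff]
    rw [Finset.sum_eq_single ω]
    · simp
    · intro σ _ h
      exact if_neg fun h' => h (funext h')
    · simp
  · obtain ⟨v, hv, hmax⟩ := G.wellFounded_descendant.has_min (A : Set V) hA
    have hun : A = A.erase v ∪ {v} := by
      rw [Finset.union_comm, ← Finset.insert_eq, Finset.insert_erase hv]
    have hdis : Disjoint (A.erase v) {v} := by simp
    have hprod : (fun σ => ∏ i ∈ A, M.factor σ i) =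
        fun σ => (∏ i ∈ A.erase v, M.factor σ i) * M.factor σ v :=
      funext fun σ => (Finset.prod_erase_mul A _ hv).symm
    have hdep := M.dependsOn_prod_factor (A := A.erase v) (D := {v}ᶜ)
      (by intro u hu; simpa using Finset.ne_of_mem_erase hu)
      (by
        rintro u w hw huw rfl
        exact hmax w (Finset.mem_of_mem_erase hw) (.single huw))
    have key : sumOver A (fun σ => ∏ i ∈ A, M.factor σ i) ω =
        sumOver (A.erase v) (fun σ => ∏ i ∈ A.erase v, M.factor σ i) ω := by
      rw [hprod, congrArg (sumOver · _ ω) hun]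
      rw [← sumOver_sumOver hdis, sumOver_mul_left hdep (by simp)]
      simp only [M.sumOver_factor, mul_one]
    rw [key]
    exact ih _ (Finset.erase_ssubset hv) ω

lemma sum_joint : ∑ ω : (∀ v, S v), M.joint ω = 1 := by
  have ω₀ : ∀ v, S v := fun v => (M.nonempty_state v).some
  rw [← sumOver_univ _ ω₀]
  exact M.sumOver_prod_factor _ _

end CausalModel

lemma DependsOn.mul_real {V : Type*} {S : V → Type*} {f g : (∀ v, S v) → ℝ} {D : Set V} (hf : DependsOn f D)
    (hg : DependsOn g D) : DependsOn (fun ω => f ω * g ω) D := by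
  intro σ τ h
  simp only [hf h, hg h]

/-! ### The front-door partition of the nodes. -/

namespace CausalDiagram

variable {V : Type*} [Fintype V] [DecidableEq V]

/-- The decomposition of the variables on which front-door adjustment rests: the tables of the
mediators `Z` and of `B` involve only `X`, `Z` and `B`, those of `E ∋ Y` only `E` and `Z`,
and `T ⊆ E` is an ancestral set containing the parents of `X`. -/
structure FrontDoorPartition (G : CausalDiagram V) (X Y : V) (Z B E T : Finset V) : Prop where
  disjoint_B_Z : Disjoint B Z
  disjoint_E_Z : Disjoint E Z
  disjoint_E_B : Disjoint E B
  notMem_Z : X ∉ Z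
  notMem_B : X ∉ B
  notMem_E : X ∉ E
  mem_E : Y ∈ E
  subset : T ⊆ E
  parent_B : ∀ a b, G.Edge a b → b ∈ B ∪ Z → a ∈ insert X (B ∪ Z)
  parent_E : ∀ a b, G.Edge a b → b ∈ E → a ∈ E ∪ Z
  parent_X : ∀ a, G.Edge a X → a ∈ T
  parent_T : ∀ a b, G.Edge a b → b ∈ T → a ∈ T

/-- `not_confounded` separates T from Z and B, `not_ancestorOfOutcome` separates the ancestors of Y
from B, and `not_edge` keeps X out of the parents of E. -/
lemma FrontDoor.exists_partition {G : CausalDiagram V} {X Y : V} {Z : Finset V}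
    (h : G.FrontDoor X Y (Z : Set V)) : ∃ B E T, G.FrontDoorPartition X Y Z B E T := by
  classical
  have hX : X ∉ Z := by simpa using h.left_notMem
  refine ⟨Finset.univ.filter (G.AncestorOfSet X Z),
    Finset.univ.filter fun v => Relation.TransGen G.Edge v X ∨ G.AncestorOfOutcome X Y Z v,
    Finset.univ.filter fun v => Relation.TransGen G.Edge v X, ?_, ?_, ?_, hX, ?_, ?_, ?_, ?_, ?_,
    ?_, ?_, ?_⟩
  · rw [Finset.disjoint_left]
    intro a ha haZ
    exact (Finset.mem_filter.1 ha).2.notMem.1 haZ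
  · rw [Finset.disjoint_left]
    intro a ha haZ
    rcases (Finset.mem_filter.1 ha).2 with ha | ha
    · exact h.not_confounded a ha (Or.inl haZ)
    · exact ha.1 haZ
  · rw [Finset.disjoint_left]
    intro a ha haB
    have haB := (Finset.mem_filter.1 haB).2
    rcases (Finset.mem_filter.1 ha).2 with ha | ha
    · exact h.not_confounded a ha (Or.inr haB)
    · exact h.not_ancestorOfOutcome a haB ha
  · intro ha
    exact (Finset.mem_filter.1 ha).2.notMem.2 rfl
  · intro ha
    rcases (Finset.mem_filter.1 ha).2 with ha | ha
    · exact G.acyclic X ha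
    · exact ha.2.1 rfl
  · exact Finset.mem_filter.2 ⟨Finset.mem_univ _, Or.inr ⟨h.right_notMem, h.ne.symm, .refl⟩⟩
  · intro a ha
    exact Finset.mem_filter.2 ⟨Finset.mem_univ _, Or.inl (Finset.mem_filter.1 ha).2⟩
  · intro a b hab hb
    simp only [Finset.mem_insert, Finset.mem_union, Finset.mem_filter, Finset.mem_univ,
      true_and] at hb ⊢
    by_cases haX : a = X
    · exact Or.inl haX
    by_cases haZ : a ∈ Z
    · exact Or.inr (Or.inr haZ)
    exact Or.inr (Or.inl (AncestorOfSet.of_edge hab hb haZ haX))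
  · intro a b hab hb
    simp only [Finset.mem_union, Finset.mem_filter, Finset.mem_univ, true_and] at hb ⊢
    rcases hb with hb | hb
    · exact Or.inl (Or.inl (.head hab hb))
    · by_cases haZ : a ∈ Z
      · exact Or.inr haZ
      have haX : a ≠ X := by
        rintro rfl
        exact h.not_edge hb hab
      exact Or.inl (Or.inr (hb.of_edge hab haZ haX))
  · intro a ha
    exact Finset.mem_filter.2 ⟨Finset.mem_univ _, .single ha⟩
  · intro a b hab hb
    exact Finset.mem_filter.2 ⟨Finset.mem_univ _, .head hab (Finset.mem_filter.1 hb).2⟩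

end CausalDiagram

/-! ### Factorization along the partition and front-door adjustment. -/

namespace CausalModel

section

variable {V : Type*} [DecidableEq V] {G : CausalDiagram V} {S : V → Type*} [∀ v, Fintype (S v)]
  (M : CausalModel G S) {X Y : V} {Z B E T : Finset V}

/-- The variables outside `Z ∪ B ∪ E ∪ {X}`, which are summed out first. -/
def remaining [Fintype V] (X : V) (Z B E : Finset V) : Finset V := (insert X (B ∪ Z) ∪ E)ᶜ

lemma prod_erase_eq [Fintype V] (h : G.FrontDoorPartition X Y Z B E T) (ω : ∀ v, S v) :
    ∏ v ∈ Finset.univ.erase X, M.factor ω v =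
      (∏ v ∈ B ∪ Z, M.factor ω v) * (∏ v ∈ E, M.factor ω v) *
        ∏ v ∈ remaining X Z B E, M.factor ω v := by
  have h1 : Disjoint (B ∪ Z) E :=
    Finset.disjoint_union_left.2 ⟨h.disjoint_E_B.symm, h.disjoint_E_Z.symm⟩
  have h2 : Disjoint (B ∪ Z ∪ E) (remaining X Z B E) := by
    rw [Finset.disjoint_left]
    intro a ha
    simp only [remaining, Finset.mem_union, Finset.mem_compl, Finset.mem_insert] at ha ⊢
    tauto
  rw [← Finset.prod_union h1, ← Finset.prod_union h2]
  refine Finset.prod_congr ?_ fun _ _ => rfl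
  ext a
  have := h.notMem_Z
  have := h.notMem_B
  have := h.notMem_E
  simp only [remaining, Finset.mem_union, Finset.mem_compl, Finset.mem_insert, Finset.mem_erase,
    Finset.mem_univ, and_true]
  by_cases ha : a = X
  · subst ha; tauto
  · tauto

lemma joint_eq [Fintype V] (h : G.FrontDoorPartition X Y Z B E T) (ω : ∀ v, S v) :
    M.joint ω = (∏ v ∈ B ∪ Z, M.factor ω v) * ((∏ v ∈ E, M.factor ω v) * M.factor ω X) *
        ∏ v ∈ remaining X Z B E, M.factor ω v := by
  rw [joint, ← Finset.mul_prod_erase _ _ (Finset.mem_univ X), M.prod_erase_eq h]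
  ring

lemma dependsOn_prod_mediators (h : G.FrontDoorPartition X Y Z B E T) :
    DependsOn (fun ω => ∏ v ∈ B ∪ Z, M.factor ω v) (insert X (B ∪ Z) : Finset V) :=
  M.dependsOn_prod_factor (fun v hv => by simpa using Or.inr (by simpa using hv))
    fun u v hv huv => h.parent_B u v huv hv

lemma dependsOn_prod_outcome (h : G.FrontDoorPartition X Y Z B E T) :
    DependsOn (fun ω => ∏ v ∈ E, M.factor ω v) (E ∪ Z : Finset V) :=
  M.dependsOn_prod_factor (fun v hv => by simpa using Or.inl hv)
    fun u v hv huv => h.parent_E u v huv hv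

lemma dependsOn_factor_treatment (h : G.FrontDoorPartition X Y Z B E T) :
    DependsOn (fun ω => M.factor ω X) (insert X T : Finset V) := by
  refine (M.dependsOn_factor X).mono ?_
  rintro u (rfl | hu)
  · simp
  · simpa using Or.inr (h.parent_X u hu)

end

variable {V : Type*} [Fintype V] [DecidableEq V] {G : CausalDiagram V} {S : V → Type*}
  [∀ v, Fintype (S v)] [∀ v, DecidableEq (S v)] (M : CausalModel G S)
  {X Y : V} {Z B E T : Finset V}

/-- Summing out everything but `X` and `Z` separates the mediators from the outcome. -/
lemma sumOver_compl_eq_mul (h : G.FrontDoorPartition X Y Z B E T) {ψ : (∀ v, S v) → ℝ}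
    (hψ : DependsOn ψ (insert X (E ∪ Z) : Finset V)) :
    sumOver (insert X Z)ᶜ (fun ω => (∏ v ∈ B ∪ Z, M.factor ω v) * ψ ω *
        ∏ v ∈ remaining X Z B E, M.factor ω v) =
      fun ω => sumOver B (fun σ => ∏ v ∈ B ∪ Z, M.factor σ v) ω * sumOver E ψ ω := by
  have hXB := h.notMem_B
  have hXE := h.notMem_E
  have hEZ : ∀ a ∈ E, a ∉ Z := fun a ha => Finset.disjoint_left.1 h.disjoint_E_Z ha
  have hEB : ∀ a ∈ E, a ∉ B := fun a ha => Finset.disjoint_left.1 h.disjoint_E_B ha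
  have hBZ : ∀ a ∈ B, a ∉ Z := fun a ha => Finset.disjoint_left.1 h.disjoint_B_Z ha
  have hset : (insert X Z)ᶜ = E ∪ (B ∪ remaining X Z B E) := by
    ext a
    have := hEZ a
    have := hBZ a
    simp only [remaining, Finset.mem_union, Finset.mem_compl, Finset.mem_insert]
    by_cases ha : a = X
    · subst ha; tauto
    · tauto
  have hd1 : Disjoint B (remaining X Z B E) := by
    rw [Finset.disjoint_left]
    intro a ha
    simp only [remaining, Finset.mem_union, Finset.mem_compl, Finset.mem_insert]
    tauto
  have hd2 : Disjoint E (B ∪ remaining X Z B E) := by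
    rw [Finset.disjoint_left]
    intro a ha
    have := hEB a ha
    simp only [remaining, Finset.mem_union, Finset.mem_compl, Finset.mem_insert]
    tauto
  have hFdep := (M.dependsOn_prod_mediators h)
  have hall : DependsOn (fun ω => (∏ v ∈ B ∪ Z, M.factor ω v) * ψ ω)
      (insert X (B ∪ Z) ∪ E : Finset V) := by
    refine DependsOn.mul_real (hFdep.mono ?_) (hψ.mono ?_)
    · intro a ha
      simp only [Finset.mem_coe, Finset.mem_union, Finset.mem_insert] at ha ⊢
      tauto
    · intro a ha
      simp only [Finset.mem_coe, Finset.mem_union, Finset.mem_insert] at ha ⊢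
      tauto
  -- The order of summation matters: the remaining nodes first, as they enter no other table
  -- involved; then B, on which ψ does not depend; then E, on which the resulting mediator factor
  -- does not depend.
  rw [hset, ← sumOver_sumOver hd2, ← sumOver_sumOver hd1,
    sumOver_mul_left hall (fun v hv => by rw [remaining, Finset.mem_compl, not_not]; exact hv)]
  simp only [M.sumOver_prod_factor, mul_one]
  have hswap : (fun ω => (∏ v ∈ B ∪ Z, M.factor ω v) * ψ ω) =
      fun ω => ψ ω * ∏ v ∈ B ∪ Z, M.factor ω v := funext fun ω => mul_comm _ _
  rw [hswap, sumOver_mul_left hψ]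
  · have hswap : (fun ω => ψ ω * sumOver B (fun σ => ∏ v ∈ B ∪ Z, M.factor σ v) ω) =
      fun ω => sumOver B (fun σ => ∏ v ∈ B ∪ Z, M.factor σ v) ω * ψ ω :=
        funext fun ω => mul_comm _ _
    rw [hswap, sumOver_mul_left (hFdep.sumOver B (D' := (insert X Z : Finset V)) ?_)]
    · intro v hv
      simp only [Finset.mem_coe, Finset.mem_insert] at hv
      rcases hv with rfl | hv
      · exact hXE
      · exact fun hE => hEZ v hE hv
    · intro v hv hvB
      simp only [Finset.mem_coe, Finset.mem_union, Finset.mem_insert] at hv ⊢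
      tauto
  · intro v hv
    simp only [Finset.mem_coe, Finset.mem_union, Finset.mem_insert] at hv
    rcases hv with rfl | hv | hv
    · exact hXB
    · exact hEB v hv
    · exact fun hB => hBZ v hB hv

/-- The marginal of `X` computed from the variables in `E` does not depend on the mediators. -/
lemma dependsOn_sumOver_outcome (h : G.FrontDoorPartition X Y Z B E T) :
    DependsOn (sumOver E fun ω => (∏ v ∈ E, M.factor ω v) * M.factor ω X) {X} := by
  have hTE : Disjoint T (E \ T) := Finset.disjoint_sdiff
  have hE : E = T ∪ E \ T := (Finset.union_sdiff_of_subset h.subset).symm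
  have hdep : DependsOn (fun ω => (∏ v ∈ T, M.factor ω v) * M.factor ω X)
      (insert X T : Finset V) :=
    DependsOn.mul_real
      (M.dependsOn_prod_factor (fun v hv => by simpa using Or.inr hv)
        fun u v hv huv => by simpa using Or.inr (h.parent_T u v huv hv))
      (M.dependsOn_factor_treatment h)
  have hprod : (fun ω => (∏ v ∈ E, M.factor ω v) * M.factor ω X) =
      fun ω => ((∏ v ∈ T, M.factor ω v) * M.factor ω X) * ∏ v ∈ E \ T, M.factor ω v := by
    funext ω
    conv_lhs => rw [hE]
    rw [Finset.prod_union hTE]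
    ring
  -- Since T is ancestral and contains the parents of X, the tables of E \ T sum to 1, leaving a
  -- function of X and T.
  have hsum : sumOver E (fun ω => (∏ v ∈ E, M.factor ω v) * M.factor ω X) =
      sumOver T fun ω => (∏ v ∈ T, M.factor ω v) * M.factor ω X := by
    rw [hprod]
    rw [congrArg (sumOver · _) hE]
    rw [← sumOver_sumOver hTE, sumOver_mul_left hdep]
    · simp only [M.sumOver_prod_factor, mul_one]
    · intro v hv
      simp only [Finset.mem_coe, Finset.mem_insert] at hv
      rcases hv with rfl | hv
      · exact fun h' => h.notMem_E (Finset.mem_sdiff.1 h').1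
      · exact fun h' => (Finset.mem_sdiff.1 h').2 hv
  rw [hsum]
  refine hdep.sumOver T ?_
  intro v hv hvT
  simp only [Finset.mem_coe, Finset.mem_insert] at hv
  exact hv.resolve_right hvT

/-- Front-door adjustment, for a function `φ` of the outcome variables. -/
theorem frontDoor_adjustment (h : G.FrontDoorPartition X Y Z B E T) {φ : (∀ v, S v) → ℝ}
    (hφ : DependsOn φ E) (hpos : ∀ ω, 0 < sumOver (insert X Z)ᶜ M.joint ω) :
    sumOver (Finset.univ.erase X) (fun ω => φ ω * ∏ v ∈ Finset.univ.erase X, M.factor ω v) =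
      sumOver Z fun σ => sumOver (insert X Z)ᶜ M.joint σ /
          sumOver (Finset.univ.erase X) M.joint σ *
        sumOver {X} (fun τ => sumOver (insert X Z)ᶜ (fun ω => φ ω * M.joint ω) τ *
          sumOver (Finset.univ.erase X) M.joint τ / sumOver (insert X Z)ᶜ M.joint τ) σ := by
  have hXE := h.notMem_E
  have hXZ := h.notMem_Z
  have herase : Finset.univ.erase X = Z ∪ (insert X Z)ᶜ := by
    ext a
    simp only [Finset.mem_erase, Finset.mem_univ, and_true, Finset.mem_union, Finset.mem_compl,
      Finset.mem_insert]
    by_cases ha : a = X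
    · subst ha; tauto
    · tauto
  have hdZ : Disjoint Z (insert X Z)ᶜ := by
    rw [Finset.disjoint_left]
    intro a ha
    simp [ha]
  have hφE : DependsOn (fun ω => φ ω * ∏ v ∈ E, M.factor ω v) (E ∪ Z : Finset V) :=
    DependsOn.mul_real (hφ.mono (by simp)) (M.dependsOn_prod_outcome h)
  have hfX : DependsOn (fun ω => M.factor ω X) (insert X (E ∪ Z) : Finset V) :=
    (M.dependsOn_factor_treatment h).mono (by
      intro a ha
      simp only [Finset.mem_coe, Finset.mem_union, Finset.mem_insert] at ha ⊢
      rcases ha with ha | ha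
      · exact Or.inl ha
      · exact Or.inr (Or.inl (h.subset ha)))
  have hsub : ((E ∪ Z : Finset V) : Set V) ⊆ (insert X (E ∪ Z) : Finset V) := by
    intro a ha
    simpa using Or.inr (by simpa using ha)
  have hz : sumOver (insert X Z)ᶜ M.joint = fun ω =>
      sumOver B (fun σ => ∏ v ∈ B ∪ Z, M.factor σ v) ω *
        sumOver E (fun σ => (∏ v ∈ E, M.factor σ v) * M.factor σ X) ω := by
    rw [show M.joint = _ from funext fun ω => M.joint_eq h ω]
    exact M.sumOver_compl_eq_mul h
      (DependsOn.mul_real ((M.dependsOn_prod_outcome h).mono hsub) hfX)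
  have hyz : sumOver (insert X Z)ᶜ (fun ω => φ ω * M.joint ω) = fun ω =>
      sumOver B (fun σ => ∏ v ∈ B ∪ Z, M.factor σ v) ω *
        sumOver E (fun σ => (φ σ * ∏ v ∈ E, M.factor σ v) * M.factor σ X) ω := by
    rw [show (fun ω => φ ω * M.joint ω) = fun ω => (∏ v ∈ B ∪ Z, M.factor ω v) *
        ((φ ω * ∏ v ∈ E, M.factor ω v) * M.factor ω X) *
        ∏ v ∈ remaining X Z B E, M.factor ω v from funext fun ω => by rw [M.joint_eq h ω]; ring]
    exact M.sumOver_compl_eq_mul h (DependsOn.mul_real (hφE.mono hsub) hfX)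
  have hdo : sumOver (insert X Z)ᶜ (fun ω => φ ω * ∏ v ∈ Finset.univ.erase X, M.factor ω v) =
      fun ω => sumOver B (fun σ => ∏ v ∈ B ∪ Z, M.factor σ v) ω *
        sumOver E (fun σ => φ σ * ∏ v ∈ E, M.factor σ v) ω := by
    rw [show (fun ω => φ ω * ∏ v ∈ Finset.univ.erase X, M.factor ω v) =
        fun ω => (∏ v ∈ B ∪ Z, M.factor ω v) * (φ ω * ∏ v ∈ E, M.factor ω v) *
        ∏ v ∈ remaining X Z B E, M.factor ω v from
          funext fun ω => by rw [M.prod_erase_eq h ω]; ring]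
    exact M.sumOver_compl_eq_mul h (hφE.mono hsub)
  set F := sumOver B fun σ => ∏ v ∈ B ∪ Z, M.factor σ v with hF
  set K := sumOver E fun ω => (∏ v ∈ E, M.factor ω v) * M.factor ω X with hK
  -- K depends on x alone, and F(x, ·) sums to 1 over Z because it comes from whole tables of B ∪ Z.
  have hx : sumOver (Finset.univ.erase X) M.joint = K := by
    rw [herase, ← sumOver_sumOver hdZ, hz]
    rw [show (fun ω => F ω * K ω) = fun ω => K ω * F ω from funext fun ω => mul_comm _ _,
      sumOver_mul_left (M.dependsOn_sumOver_outcome h) (by simpa using hXZ), hF,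
      sumOver_sumOver h.disjoint_B_Z.symm, Finset.union_comm Z B]
    simp only [M.sumOver_prod_factor, mul_one]
    rfl
  -- The table of X is the only factor that involves X, so summing over x' removes it.
  have hsumX : sumOver {X} (sumOver E fun ω => (φ ω * ∏ v ∈ E, M.factor ω v) * M.factor ω X) =
      sumOver E fun ω => φ ω * ∏ v ∈ E, M.factor ω v := by
    have hd : Disjoint {X} E := by simpa using hXE
    rw [sumOver_sumOver hd, Finset.union_comm, ← sumOver_sumOver hd.symm, sumOver_mul_left hφE]
    · simp only [M.sumOver_factor, mul_one]
    · intro v hv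
      simp only [Finset.mem_coe, Finset.mem_union] at hv
      rw [Finset.mem_singleton]
      rintro rfl
      exact hv.elim hXE hXZ
  have hFK : ∀ ω, F ω * K ω ≠ 0 := fun ω => by
    have := hpos ω
    rw [hz] at this
    exact this.ne'
  rw [congrArg (sumOver · _) herase]
  rw [← sumOver_sumOver hdZ, hdo, hx, hz, hyz, ← hsumX]
  congr 1
  funext σ
  congr 1
  -- The weight is F K / K = F; in the next goal F L K / (F K) = L, L being the sum over E in `hyz`.
  · have := right_ne_zero_of_mul (hFK σ)
    field_simp
  · congr 1
    funext τ
    have h1 := right_ne_zero_of_mul (hFK τ)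
    have h2 := left_ne_zero_of_mul (hFK τ)
    field_simp

end CausalModel

/-! ### Boundedness of the objective. -/

namespace FrontDoorProblem

variable {α β γ δ : Type*} [Fintype α] [Fintype β] [Fintype γ] [Fintype δ]

/-- The values of the objective lie between `0` and an explicit bound. -/
lemma values_subset_Icc {pxyw : α → β → γ → ℝ} (hp : ∀ x y w, 0 ≤ pxyw x y w) (pu : δ → ℝ)
    (x : α) (y : β) :
    values pxyw pu x y ⊆ Set.Icc 0
      (∑ w, ∑ _u : δ, pxw pxyw x w / px pxyw x * ∑ x', px pxyw x') := by
  rintro t ⟨a, b, h, hb, rfl⟩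
  have hpxw : ∀ x w, 0 ≤ pxw pxyw x w := fun x w => Finset.sum_nonneg fun y _ => hp x y w
  have hpx : ∀ x, 0 ≤ px pxyw x := fun x => Finset.sum_nonneg fun w _ => hpxw x w
  have ha0 : ∀ x w u, 0 ≤ a x w u := fun x w u => (le_max_left _ _).trans (h.le_a x w u)
  have hb0 : ∀ x w u, 0 < b x w u := fun x w u =>
    lt_of_le_of_ne ((le_max_left _ _).trans (h.le_b x w u)) (hb x w u).symm
  have hinner0 : ∀ w u, 0 ≤ ∑ x', a x' w u * px pxyw x' / b x' w u := fun w u =>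
    Finset.sum_nonneg fun x' _ =>
      div_nonneg (mul_nonneg (ha0 x' w u) (hpx x')) (hb0 x' w u).le
  constructor
  · exact Finset.sum_nonneg fun w _ => Finset.sum_nonneg fun u _ =>
      mul_nonneg (div_nonneg (hb0 x w u).le (hpx x)) (hinner0 w u)
  -- Each outer b is at most P(x,w), and each inner ratio a/b is at most 1.
  · refine Finset.sum_le_sum fun w _ => Finset.sum_le_sum fun u _ => ?_
    refine mul_le_mul ?_ ?_ (hinner0 w u) (div_nonneg (hpxw x w) (hpx x))
    · exact div_le_div_of_nonneg_right ((h.b_le x w u).trans (min_le_left _ _)) (hpx x)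
    · refine Finset.sum_le_sum fun x' _ => ?_
      rw [div_le_iff₀ (hb0 x' w u), mul_comm]
      exact mul_le_mul_of_nonneg_left (h.a_le_b x' w u) (hpx x')

end FrontDoorProblem

/-! ### Feasibility of the true marginals. -/

namespace CausalModel

variable {V : Type*} [Fintype V] [DecidableEq V] {G : CausalDiagram V} {S : V → Type*}
  [∀ v, Fintype (S v)] (M : CausalModel G S)

/-- The probability of an event. -/
def prob (p : (∀ v, S v) → Prop) [DecidablePred p] : ℝ :=
  ∑ ω : (∀ v, S v), if p ω then M.joint ω else 0

variable {p q : (∀ v, S v) → Prop} [DecidablePred p] [DecidablePred q]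

lemma prob_nonneg : 0 ≤ M.prob p :=
  Finset.sum_nonneg fun ω _ => by split_ifs <;> simp [M.joint_nonneg]

lemma prob_mono (h : ∀ ω, p ω → q ω) : M.prob p ≤ M.prob q := by
  refine Finset.sum_le_sum fun ω _ => ?_
  have := M.joint_nonneg ω
  by_cases hp : p ω
  · rw [if_pos hp, if_pos (h ω hp)]
  · rw [if_neg hp]
    split_ifs <;> simp [this]

/-- Marginalization over the values of a variable `g`. -/
lemma sum_prob {κ : Type*} [Fintype κ] [DecidableEq κ] (g : (∀ v, S v) → κ)
    {r : κ → (∀ v, S v) → Prop} [∀ k, DecidablePred (r k)]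
    (h : ∀ k ω, r k ω ↔ p ω ∧ g ω = k) : ∑ k, M.prob (r k) = M.prob p := by
  unfold prob
  rw [Finset.sum_comm]
  refine Finset.sum_congr rfl fun ω _ => ?_
  have h1 : ∀ k, (if r k ω then M.joint ω else 0) =
      if g ω = k then (if p ω then M.joint ω else 0) else 0 := by
    intro k
    rw [if_congr (h k ω) rfl rfl]
    by_cases hp : p ω <;> by_cases hk : g ω = k <;> simp [hp, hk]
  simp_rw [h1]
  simp

variable [∀ v, DecidableEq (S v)]

/-- The Fréchet lower bound. -/
lemma prob_add_prob_sub_one_le {r : (∀ v, S v) → Prop} [DecidablePred r]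
    (h : ∀ ω, p ω → q ω → r ω) : M.prob p + M.prob q - 1 ≤ M.prob r := by
  -- Writing 1 as the total mass reduces the bound to a pointwise inequality between indicators.
  rw [← M.sum_joint, prob, prob, prob, ← Finset.sum_add_distrib, ← Finset.sum_sub_distrib]
  refine Finset.sum_le_sum fun ω _ => ?_
  have := M.joint_nonneg ω
  by_cases hp : p ω <;> by_cases hq : q ω
  · simp [hp, hq, h ω hp hq]
  all_goals
    simp only [hp, hq, if_true, if_false]
    split_ifs <;> linarith

/-- The marginal `P(x, y, w, u)`. -/
def probXYWU (X Y : V) (W U : Finset V) (x : S X) (y : S Y) (w : (v : W) → S v)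
    (u : (v : U) → S v) : ℝ :=
  M.prob fun ω => ω X = x ∧ ω Y = y ∧ (fun v : W => ω v) = w ∧ (fun v : U => ω v) = u

lemma pxw_eq (X Y : V) (W : Finset V) (x : S X) (w : (v : W) → S v) :
    FrontDoorProblem.pxw (M.probXYW X Y W) x w =
      M.prob fun ω => ω X = x ∧ (fun v : W => ω v) = w :=
  M.sum_prob (fun ω => ω Y) fun k ω => by tauto

lemma px_eq (X Y : V) (W : Finset V) (x : S X) :
    FrontDoorProblem.px (M.probXYW X Y W) x = M.prob fun ω => ω X = x := by
  unfold FrontDoorProblem.px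
  simp_rw [M.pxw_eq]
  exact M.sum_prob (fun ω => fun v : W => ω v) fun k ω => Iff.rfl

/-- The true marginals satisfy the constraints. -/
lemma feasible (X Y : V) (W U : Finset V) (y : S Y) :
    FrontDoorProblem.Feasible (M.probXYW X Y W) (M.probU U) y
      (fun x w u => M.probXYWU X Y W U x y w u) (fun x w u => M.probXWU X W U x w u) where
  sum_a x w := M.sum_prob (fun ω => fun v : U => ω v) fun k ω => by tauto
  sum_b x w := by
    rw [M.pxw_eq]
    exact M.sum_prob (fun ω => fun v : U => ω v) fun k ω => by tauto
  a_le_b x w u := M.prob_mono fun ω => by tauto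
  le_a x w u := max_le M.prob_nonneg (M.prob_add_prob_sub_one_le fun ω => by tauto)
  a_le x w u := le_min (M.prob_mono fun ω => by tauto) (M.prob_mono fun ω => by tauto)
  le_b x w u := by
    rw [M.pxw_eq]
    exact max_le M.prob_nonneg (M.prob_add_prob_sub_one_le fun ω => by tauto)
  b_le x w u := by
    rw [M.pxw_eq]
    exact le_min (M.prob_mono fun ω => by tauto) (M.prob_mono fun ω => by tauto)

/-! ### Identification of the objective with the causal effect. -/

variable {X Y : V} {W U : Finset V}

lemma probXWU_eq_sumOver (σ : ∀ v, S v) :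
    M.probXWU X W U (σ X) (fun v => σ v) (fun v => σ v) =
      sumOver (insert X (W ∪ U))ᶜ M.joint σ := by
  refine sumOver_eq_sum_ite _ _ _ _ fun ω => ?_
  simp only [Finset.mem_compl, not_not, Finset.mem_insert, Finset.mem_union, funext_iff,
    Subtype.forall]
  constructor
  · rintro ⟨h1, h2, h3⟩ v (rfl | hv | hv)
    exacts [h1, h2 v hv, h3 v hv]
  · intro h
    exact ⟨h X (Or.inl rfl), fun v hv => h v (Or.inr (Or.inl hv)),
      fun v hv => h v (Or.inr (Or.inr hv))⟩

/-- The outcome enters as a weight rather than a fixed coordinate, so y need not be the state of Y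
in σ. -/
lemma probXYWU_eq_sumOver (y : S Y) (σ : ∀ v, S v) :
    M.probXYWU X Y W U (σ X) y (fun v => σ v) (fun v => σ v) =
      sumOver (insert X (W ∪ U))ᶜ (fun ω => (if ω Y = y then 1 else 0) * M.joint ω) σ := by
  rw [← sumOver_eq_sum_ite _ _ _
    (fun ω => ω X = σ X ∧ (fun v : W => ω v) = (fun v : W => σ v) ∧
      (fun v : U => ω v) = (fun v : U => σ v))]
  · refine Finset.sum_congr rfl fun ω _ => ?_
    by_cases hy : ω Y = y <;> simp [hy]
  · intro ω
    simp only [Finset.mem_compl, not_not, Finset.mem_insert, Finset.mem_union, funext_iff,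
      Subtype.forall]
    constructor
    · rintro ⟨h1, h2, h3⟩ v (rfl | hv | hv)
      exacts [h1, h2 v hv, h3 v hv]
    · intro h
      exact ⟨h X (Or.inl rfl), fun v hv => h v (Or.inr (Or.inl hv)),
        fun v hv => h v (Or.inr (Or.inr hv))⟩

lemma px_eq_sumOver (σ : ∀ v, S v) :
    FrontDoorProblem.px (M.probXYW X Y W) (σ X) = sumOver (Finset.univ.erase X) M.joint σ := by
  rw [M.px_eq]
  refine sumOver_eq_sum_ite _ _ _ _ fun ω => ?_
  simp

lemma causalEffect_eq_sumOver (y : S Y) (σ : ∀ v, S v) :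
    M.causalEffect X Y (σ X) y = sumOver (Finset.univ.erase X)
      (fun ω => (if ω Y = y then 1 else 0) * ∏ v ∈ Finset.univ.erase X, M.factor ω v) σ := by
  rw [← sumOver_eq_sum_ite _ _ _ (fun ω => ω X = σ X) (by simp)]
  refine Finset.sum_congr rfl fun ω _ => ?_
  by_cases hy : ω Y = y <;> simp [hy, doJoint]

/-- At the true marginals, the objective is the causal effect. -/
theorem objective_eq_causalEffect (hWU : Disjoint W U)
    (hfd : G.FrontDoor X Y ((W ∪ U : Finset V) : Set V))
    (hpos : ∀ (x : S X) (w : (v : W) → S v) (u : (v : U) → S v), 0 < M.probXWU X W U x w u)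
    (x : S X) (y : S Y) :
    FrontDoorProblem.objective (M.probXYW X Y W) x (fun x w u => M.probXYWU X Y W U x y w u)
      (fun x w u => M.probXWU X W U x w u) = M.causalEffect X Y x y := by
  obtain ⟨B, E, T, h⟩ := hfd.exists_partition
  have hXW : X ∉ W := fun h' => h.notMem_Z (Finset.mem_union_left _ h')
  have hXU : X ∉ U := fun h' => h.notMem_Z (Finset.mem_union_right _ h')
  have hφ : DependsOn (fun ω : (∀ v, S v) => if ω Y = y then (1 : ℝ) else 0) E := by
    intro σ τ hστ
    simp only [hστ Y h.mem_E]
  have hadj := M.frontDoor_adjustment h hφ fun ω => by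
    rw [← M.probXWU_eq_sumOver]
    exact hpos _ _ _
  -- The adjustment formula is evaluated at full assignments; any one with state x at X will do.
  obtain ⟨ω, rfl⟩ : ∃ ω : (∀ v, S v), ω X = x :=
    ⟨Function.update (fun v => (M.nonempty_state v).some) X x, Function.update_self ..⟩
  rw [M.causalEffect_eq_sumOver, hadj, sumOver_union_eq_sum_sum hWU]
  refine Finset.sum_congr rfl fun w _ => Finset.sum_congr rfl fun u _ => ?_
  -- Naming the merged assignment lets x, w and u all be read as restrictions of σ; below, τ does
  -- the same for x'.
  obtain ⟨σ, hσ⟩ : ∃ σ, mergeStates ω w u = σ := ⟨_, rfl⟩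
  have hσX : ω X = σ X := by simp [← hσ, mergeStates, hXW, hXU]
  have hσW : w = fun v : W => σ v := by
    funext v
    simp [← hσ, mergeStates]
  have hσU : u = fun v : U => σ v := by
    funext v
    simp [← hσ, mergeStates, Finset.disjoint_right.1 hWU v.2]
  rw [hσ, hσX, sumOver_singleton, M.px_eq_sumOver, hσW, hσU]
  beta_reduce
  rw [M.probXWU_eq_sumOver]
  congr 1
  refine Finset.sum_congr rfl fun x' _ => ?_
  obtain ⟨τ, hτ⟩ : ∃ τ, Function.update σ X x' = τ := ⟨_, rfl⟩
  have hτX : x' = τ X := by simp [← hτ]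
  have hτW : (fun v : W => σ v) = fun v : W => τ v := by
    funext v
    rw [← hτ, Function.update_of_ne (ne_of_mem_of_not_mem v.2 hXW)]
  have hτU : (fun v : U => σ v) = fun v : U => τ v := by
    funext v
    rw [← hτ, Function.update_of_ne (ne_of_mem_of_not_mem v.2 hXU)]
  rw [hτ, hτX, hτW, hτU, M.probXWU_eq_sumOver, M.probXYWU_eq_sumOver, M.px_eq_sumOver]

end CausalModel

theorem theorem2 {V : Type*} [Fintype V] [DecidableEq V] (G : CausalDiagram V)
    {S : V → Type*} [∀ v, Fintype (S v)] [∀ v, DecidableEq (S v)] (M : CausalModel G S)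
    (X Y : V) (W U : Finset V) (hWU : Disjoint W U)
    (hfd : G.FrontDoor X Y ((W ∪ U : Finset V) : Set V))
    (hpos : ∀ (x : S X) (w : (v : W) → S v) (u : (v : U) → S v), 0 < M.probXWU X W U x w u)
    (x : S X) (y : S Y) :
    (FrontDoorProblem.values (M.probXYW X Y W) (M.probU U) x y).Nonempty ∧
    BddBelow (FrontDoorProblem.values (M.probXYW X Y W) (M.probU U) x y) ∧
    BddAbove (FrontDoorProblem.values (M.probXYW X Y W) (M.probU U) x y) ∧
    sInf (FrontDoorProblem.values (M.probXYW X Y W) (M.probU U) x y) ≤ M.causalEffect X Y x y ∧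
    M.causalEffect X Y x y ≤ sSup (FrontDoorProblem.values (M.probXYW X Y W) (M.probU U) x y) := by
  have hmem : M.causalEffect X Y x y ∈
      FrontDoorProblem.values (M.probXYW X Y W) (M.probU U) x y :=
    ⟨_, _, M.feasible X Y W U y, fun x w u => (hpos x w u).ne',
      M.objective_eq_causalEffect hWU hfd hpos x y⟩
  have hsub := FrontDoorProblem.values_subset_Icc (pxyw := M.probXYW X Y W)
    (fun x y w => M.prob_nonneg) (M.probU U) x y
  have hbelow := bddBelow_Icc.mono hsub
  have habove := bddAbove_Icc.mono hsub
  exact ⟨⟨_, hmem⟩, hbelow, habove, csInf_le hbelow hmem, le_csSup habove hmem⟩
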